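/- Let $d\ge 1$, let $V=\{1,\dots,d\}$, and let $\langle\cdot,\cdot\rangle$ be the Euclidean scalar product on $\mathbb{R}^d$. Let $\|\cdot\|$ be a norm on $\mathbb{R}^d$ (the source norm), with dual norm $\|y\|_\star=\sup_{\|x\|\le 1}\langle x,y\rangle$. **Notation.** For $x\in\mathbb{R}^d$, $\mathrm{supp}(x)=\{j\in V: x_j\ne 0\}$. For $K\subset V$, $\mathcal{R}_K=\{x\in\mathbb{R}^d: x_j=0\ \forall j\notin K\}$, and $x_K\in\mathcal{R}_K$ is the orthogonal projection of $x$ onto $\mathcal{R}_K$. A norm $N$ on $\mathbb{R}^d$ is *orthant-strictly monotonic* if $N(x)<N(x')$ whenever $|x_i|\le|x'_i|$ for all $i$, $|x_j|<|x'_j|$ for some $j$, and $x_ix'_i\ge 0$ for all $i$. The Capra coupling is $c(x,y)=\langle x,y\rangle/\|x\|$ if $x\ne0$ and $c(0,y)=0$; the Capra-conjugate of $f:\mathbb{R}^d\to[-\infty,+\infty]$ is $f^{c}(y)=\sup_{x}\bigl(c(x,y)-f(x)\bigr)$, and the Fenchel conjugate of $f$ is $f^{\star}(y)=\sup_{x}\bigl(\langle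 x,y\rangle-f(x)\bigr)$. The normalization mapping is $n(x)=x/\|x\|$ if $x\neq 0$ and $n(0)=0$. For $K\subset V$, let $\|y\|^{\mathrm{t}}_{K}=\sup_{J\subset K}\|y_J\|_\star$ for $y\in\mathbb{R}^d$ (a norm on $\mathcal{R}_K$, the generalized local-top-$K$ dual norm), and let $\|x\|^{\mathrm{s}}_{K}=\sup\{\langle x,y\rangle: y\in\mathcal{R}_K,\ \|y\|^{\mathrm{t}}_{K}\le1\}$, $x\in\mathcal{R}_K$, be its dual norm on $\mathcal{R}_K$ (the generalized local-$K$-support dual norm). Let $B_K=\{x\in\mathcal{R}_K:\|x\|^{\mathrm{s}}_K\le 1\}$ and $S_K=\{x\in\mathcal{R}_K:\|x\|^{\mathrm{s}}_K=1\}$ be the corresponding unit ball and unit sphere, with the conventions $B_\emptyset=S_\emptyset=\{0\}$. For $A\subset\mathbb{R}^d$, $\delta_A$ is $0$ on $A$ and $+\infty$ outside $A$. A function $f:\mathbb{R}^d\to[-\infty,+\infty]$ is *proper convex lsc* if it never takes the value $-\infty$, is not identically $+\infty$, has a convex epigraph, and is lower semicontinuous. Let $\Delta$ be the set of families $\lambda=(\lambda_K)_{K\subset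 V}$ of nonnegative reals with $\sum_{K\subset V}\lambda_K=1$. A minimum over an empty set is $+\infty$. **Proposition.** Suppose that both $\|\cdot\|$ and $\|\cdot\|_\star$ are orthant-strictly monotonic, and let $F:2^V\to\mathbb{R}$ be a finite-valued set function that is nondecreasing for inclusion. Define $\mathcal{L}_0^F=\bigl((F\circ\mathrm{supp})^{c}\bigr)^{\star}:\mathbb{R}^d\to[-\infty,+\infty]$. Then: 1. $\mathcal{L}_0^F$ is proper convex lsc. 2. $F(\mathrm{supp}(x))=\mathcal{L}_0^F(x)$ for all $x$ with $\|x\|=1$. 3. $F\circ\mathrm{supp}=\mathcal{L}_0^F\circ n$ on $\mathbb{R}^d$; in particular $F(\mathrm{supp}(x))=\mathcal{L}_0^F(x/\|x\|)$ for all $x\neq 0$. 4. $\mathcal{L}_0^F=\Bigl(\sup_{K\subset V}\bigl[\|\cdot\|^{\mathrm{t}}_{K}-F(K)\bigr]\Bigr)^{\star}$. 5. $\mathcal{L}_0^F$ is the largest proper convex lsc function below $\inf_{K\subset V}\bigl[\delta_{B_K}+F(K)\bigr]$, that is, below $x\mapsto\inf\{F(K): K\subset V,\ x\in B_K\}$ (with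 $\inf\emptyset=+\infty$). 6. $\mathcal{L}_0^F$ is the largest proper convex lsc function below $\inf_{K\subset V}\bigl[\delta_{S_K}+F(K)\bigr]$, that is, below $x\mapsto\inf\{F(K): K\subset V,\ x\in S_K\}$ (with $\inf\emptyset=+\infty$). 7. For all $x\in\mathbb{R}^d$, $$\mathcal{L}_0^F(x)=\min\Bigl\{\sum_{K\subset V}\lambda_KF(K):\lambda\in\Delta,\ x\in\sum_{K\subset V}\lambda_KB_K\Bigr\}=\min\Bigl\{\sum_{K\subset V}\lambda_KF(K):\lambda\in\Delta,\ x\in\sum_{K\subset V}\lambda_KS_K\Bigr\},$$ where the sums of sets are Minkowski sums, and, if $F(\emptyset)=0$, $$\mathcal{L}_0^F(x)=\min\Bigl\{\sum_{\emptyset\ne K\subset V}\|z_K\|^{\mathrm{s}}_KF(K): z_K\in\mathcal{R}_K,\ \sum_{\emptyset\ne K\subset V}\|z_K\|^{\mathrm{s}}_K\le1,\ \sum_{\emptyset\ne K\subset V}z_K=x\Bigr\}.$$ Each of these minima is attained whenever its feasible set is nonempty. -/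

import Mathlib

open scoped Pointwise

namespace Capra

noncomputable section

/-- The Euclidean space `ℝ^d`, with its scalar product `inner ℝ`. -/
abbrev Vec (d : ℕ) := EuclideanSpace ℝ (Fin d)

/-- The support mapping: the set of indices of the nonzero entries of `x`. -/
def supp {d : ℕ} (x : Vec d) : Finset (Fin d) := Finset.univ.filter (fun i => x i ≠ 0)

/-- The subspace of the vectors whose components vanish outside of `K`. -/
def flat {d : ℕ} (K : Finset (Fin d)) : Submodule ℝ (Vec d) where
  carrier := {x | ∀ i, i ∉ K → x i = 0}
  add_mem' := by
    intro a b ha hb i hi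
    simp [ha i hi, hb i hi]
  zero_mem' := by
    intro i _
    simp
  smul_mem' := by
    intro c x hx i hi
    simp [hx i hi]

/-- The orthogonal projection `x ↦ x_K` onto `flat K`. -/
def proj {d : ℕ} (K : Finset (Fin d)) (x : Vec d) : Vec d :=
  WithLp.toLp 2 (fun i => if i ∈ K then x i else 0)

/-- Orthant-strict monotonicity of a norm. -/
def OrthantStrictlyMonotonic {d : ℕ} (N : Vec d → ℝ) : Prop :=
  ∀ x x' : Vec d, (∀ i, |x i| ≤ |x' i|) → (∃ j, |x j| < |x' j|) →
    (∀ i, 0 ≤ x i * x' i) → N x < N x'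

/-- The dual norm `y ↦ sup {⟨x, y⟩ : N x ≤ 1}`. -/
def dualNorm {d : ℕ} (N : Vec d → ℝ) (y : Vec d) : ℝ :=
  sSup ((fun x : Vec d => inner ℝ x y) '' {x | N x ≤ 1})

/-- The dual, on the subspace `flat K`, of a norm `M` on `flat K`
(the values of `M` outside of `flat K` are not used). -/
def localDualNorm {d : ℕ} (K : Finset (Fin d)) (M : Vec d → ℝ) (y : Vec d) : ℝ :=
  sSup ((fun x : Vec d => inner ℝ x y) '' {x | x ∈ flat K ∧ M x ≤ 1})

/-- The generalized local-top-`K` dual norm `sup_{J ⊆ K} ‖y_J‖_⋆`. It is a norm on `flat K`; on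
the whole of `ℝ^d` the same formula gives the seminorm `y ↦ (its value at y_K)`. -/
def topDualNorm {d : ℕ} (N : Vec d → ℝ) (K : Finset (Fin d)) (y : Vec d) : ℝ :=
  K.powerset.sup' ⟨∅, Finset.empty_mem_powerset K⟩ (fun J => dualNorm N (proj J y))

/-- The generalized local-`K`-support dual norm on `flat K`: the dual norm, on `flat K`, of the
generalized local-top-`K` dual norm. -/
def supportDualNorm {d : ℕ} (N : Vec d → ℝ) (K : Finset (Fin d)) (x : Vec d) : ℝ :=
  localDualNorm K (topDualNorm N K) x

/-- The unit ball of the local-`K`-support dual norm (it is `{0}` when `K = ∅`). -/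
def supportBall {d : ℕ} (N : Vec d → ℝ) (K : Finset (Fin d)) : Set (Vec d) :=
  {x | x ∈ flat K ∧ supportDualNorm N K x ≤ 1}

/-- The unit sphere of the local-`K`-support dual norm, with the convention `{0}` for `K = ∅`. -/
def supportSphere {d : ℕ} (N : Vec d → ℝ) (K : Finset (Fin d)) : Set (Vec d) :=
  if K = ∅ then {0} else {x | x ∈ flat K ∧ supportDualNorm N K x = 1}

/-- The conjugate of `f` with respect to the coupling `c`. The addition of `EReal` is the
Moreau lower addition (`⊤ + ⊥ = ⊥`). -/
def conjugate {X Y : Type*} (c : X → Y → EReal) (f : X → EReal) : Y → EReal :=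
  fun y => ⨆ x, (c x y + -f x)

/-- The scalar product coupling, whose conjugacy is the Fenchel conjugacy. -/
def fenchelCoupling {d : ℕ} (x y : Vec d) : EReal := ((inner ℝ x y : ℝ) : EReal)

/-- The Fenchel conjugate. -/
def fenchelConj {d : ℕ} (f : Vec d → EReal) : Vec d → EReal := conjugate fenchelCoupling f

/-- The constant along primal rays coupling (Capra) of the source norm `N`. -/
def capraCoupling {d : ℕ} (N : Vec d → ℝ) (x y : Vec d) : EReal :=
  if x = 0 then 0 else ((inner ℝ x y / N x : ℝ) : EReal)

/-- The normalization mapping onto the unit sphere of `N` united with `{0}`. -/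
def normalization {d : ℕ} (N : Vec d → ℝ) (x : Vec d) : Vec d :=
  if x = 0 then 0 else (N x)⁻¹ • x

/-- The function `F ∘ supp`, with values in the extended reals. -/
def suppFun {d : ℕ} (F : Finset (Fin d) → ℝ) (x : Vec d) : EReal := (F (supp x) : EReal)

/-- `L₀^F`: the Fenchel conjugate of the Capra-conjugate of `F ∘ supp`. -/
def calL0 {d : ℕ} (N : Vec d → ℝ) (F : Finset (Fin d) → ℝ) : Vec d → EReal :=
  fenchelConj (conjugate (capraCoupling N) (suppFun F))

/-- Proper convex lower semicontinuous functions with values in `[-∞, +∞]`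
(convexity is convexity of the epigraph in `ℝ^d × ℝ`). -/
def ProperConvexLsc {d : ℕ} (f : Vec d → EReal) : Prop :=
  ((∀ x, f x ≠ ⊥) ∧ ∃ x, f x < ⊤) ∧
    Convex ℝ {p : Vec d × ℝ | f p.1 ≤ (p.2 : EReal)} ∧
    LowerSemicontinuous f

/-- `f` is the largest proper convex lsc function below `g`. -/
def IsLargestProperConvexLscBelow {d : ℕ} (f g : Vec d → EReal) : Prop :=
  IsGreatest {h : Vec d → EReal | ProperConvexLsc h ∧ h ≤ g} f

open Classical in
/-- The characteristic function of a set: `0` on the set, `+∞` outside. -/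
def charFun {d : ℕ} (S : Set (Vec d)) (x : Vec d) : EReal := if x ∈ S then 0 else ⊤

/-- The function `inf_K (δ_{Γ_K} + F(K))`. -/
def infCharFun {d : ℕ} (Γ : Finset (Fin d) → Set (Vec d)) (F : Finset (Fin d) → ℝ)
    (x : Vec d) : EReal :=
  ⨅ K, (charFun (Γ K) x + (F K : EReal))

/-- `m = min_{a ∈ S} φ a`: `m` is the infimum (`+∞` if `S` is empty), and it is attained as soon
as `S` is nonempty. -/
def IsMinOver {α : Type*} (m : EReal) (S : Set α) (φ : α → ℝ) : Prop :=
  (m = ⨅ a ∈ S, (φ a : EReal)) ∧ (S.Nonempty → ∃ a ∈ S, (φ a : EReal) = m)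

/-- The weights `μ` in the simplex such that `x` belongs to the Minkowski sum `∑_K μ_K Γ_K`. -/
def feasibleWeights {d : ℕ} (Γ : Finset (Fin d) → Set (Vec d)) (x : Vec d) :
    Set (Finset (Fin d) → ℝ) :=
  {μ | μ ∈ stdSimplex ℝ (Finset (Fin d)) ∧ x ∈ ∑ K, μ K • Γ K}

/-- The families `(z_K)`, over the nonempty `K`, with `z_K ∈ flat K`,
`∑_K ‖z_K‖_K ≤ 1` for the local-`K`-support dual norms, and `∑_K z_K = x`. -/
def feasibleDecompositions {d : ℕ} (N : Vec d → ℝ) (x : Vec d) :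
    Set ({K : Finset (Fin d) // K.Nonempty} → Vec d) :=
  {z | (∀ K, z K ∈ flat K.1) ∧ ∑ K, supportDualNorm N K.1 (z K) ≤ 1 ∧ ∑ K, z K = x}

end

end Capra

open Capra

/-!
The proof rests on two consequences of orthant-strict monotonicity. Since the dual norm decreases
when coordinates are erased, `topDualNorm N K y = ‖y_K‖_⋆` (`topDualNorm_eq`), and therefore, as the
bidual of `N` is `N`, the local-`K`-support dual norm on `flat K` is the source norm itself
(`supportDualNorm_eq`). So the balls and spheres of the theorem are the traces on `flat K` of those
of `N`, and the Capra-conjugate of `F ∘ supp` is the finite function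
`g y = max_K (‖y_K‖_⋆ - F K)` (`conjugate_capraCoupling`); here the monotonicity of `F` allows the
vectors of support exactly `K` to be replaced by all those of `flat K`.

The core is the duality formula: `calL0 N F x`, the supremum of `⟨x, y⟩ - g y`, is the minimum of
`∑ μ_K F K` over the simplex weights `μ` and the families `w_K ∈ flat K` with `N w_K ≤ μ_K` and
`∑ w_K = x`. One inequality is the definition of the dual norm (`calL0_le_of_mem_weightedBalls`). For
the other one (`exists_mem_weightedBalls`), the set of all such `(μ, w)` is compact and convex, hence
so is the set of the pairs `(∑ w_K, ∑ μ_K F K)` in `ℝ^d × ℝ`, and a point outside of it can be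
separated from it by a hyperplane; compactness also gives the attainment of the minimum. Since `F` is
smallest at `∅`, the weights `μ_K` can be lowered to `N w_K` for `K ≠ ∅`, the excess mass being moved
to `∅` (`exists_tight_decomposition`); this turns balls into spheres, and gives the third variational
formula. The maximality of `calL0 N F` among the convex minorants is then the Jensen inequality along
an optimal decomposition (`isLargest_calL0`).

For `N x = 1`, a vector `y` norming `x` norms each term of a decomposition of `x`, and strict
monotonicity of both norms forces `supp x ⊆ supp y ⊆ K` whenever `μ_K > 0`
(`mem_flat_of_weight_pos`). Hence every decomposition costs at least `F (supp x)`, the cost of the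
trivial one.
-/

namespace Capra

/-! ### Norms in duality on `ℝ^d` -/

section Duality

variable {d : ℕ} {N : Seminorm ℝ (Vec d)}

theorem continuous_seminorm (N : Seminorm ℝ (Vec d)) : Continuous N := by
  have h : ContinuousOn N Set.univ := ConvexOn.continuousOn isOpen_univ N.convexOn
  simpa [continuousOn_univ] using h

theorem exists_pos_mul_norm_le (hN : ∀ x, N x = 0 → x = 0) :
    ∃ c : ℝ, 0 < c ∧ ∀ x, c * ‖x‖ ≤ N x := by
  obtain ⟨c, hc, h⟩ := (isCompact_sphere (0 : Vec d) 1).exists_forall_le'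
    (continuous_seminorm N).continuousOn (a := 0) (fun x hx => by
      refine lt_of_le_of_ne (apply_nonneg N x) fun h0 => ?_
      have := hN x h0.symm
      simp [this] at hx)
  refine ⟨c, hc, fun x => ?_⟩
  by_cases hx : x = 0
  · simp [hx]
  have hx' : 0 < ‖x‖ := norm_pos_iff.2 hx
  have h1 := h (‖x‖⁻¹ • x) (by simp [norm_smul, hx'.ne'])
  rw [map_smul_eq_mul, norm_inv, norm_norm] at h1
  calc c * ‖x‖ ≤ ‖x‖⁻¹ * N x * ‖x‖ := by gcongr
    _ = N x := by field_simp

theorem isCompact_unitBall (hN : ∀ x, N x = 0 → x = 0) : IsCompact {x | N x ≤ 1} := by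
  obtain ⟨c, hc, h⟩ := exists_pos_mul_norm_le hN
  refine (isCompact_closedBall (0 : Vec d) c⁻¹).of_isClosed_subset
    (isClosed_le (continuous_seminorm N) continuous_const) fun x hx => ?_
  rw [mem_closedBall_zero_iff, ← one_div, le_div_iff₀ hc, mul_comm]
  exact (h x).trans hx

theorem exists_inner_eq_dualNorm (hN : ∀ x, N x = 0 → x = 0) (y : Vec d) :
    ∃ x : Vec d, N x ≤ 1 ∧ inner ℝ x y = dualNorm N y := by
  obtain ⟨x, hx, h⟩ := (isCompact_unitBall hN).exists_sSup_image_eq ⟨0, by simp⟩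
    (f := fun x : Vec d => inner ℝ x y) (by fun_prop)
  exact ⟨x, hx, h.symm⟩

theorem inner_le_dualNorm (hN : ∀ x, N x = 0 → x = 0) {x : Vec d} (hx : N x ≤ 1) (y : Vec d) :
    inner ℝ x y ≤ dualNorm N y :=
  le_csSup ((isCompact_unitBall hN).image (by fun_prop)).bddAbove ⟨x, hx, rfl⟩

theorem inner_le_mul_dualNorm (hN : ∀ x, N x = 0 → x = 0) (x y : Vec d) :
    inner ℝ x y ≤ N x * dualNorm N y := by
  rcases (apply_nonneg N x).eq_or_lt with h | h
  · simp [hN x h.symm]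
  have h1 := inner_le_dualNorm hN (x := (N x)⁻¹ • x)
    (by rw [map_smul_eq_mul, norm_inv, Real.norm_of_nonneg h.le, inv_mul_cancel₀ h.ne']) y
  rw [real_inner_smul_left, inv_mul_le_iff₀ h] at h1
  exact h1

theorem dualNorm_nonneg (hN : ∀ x, N x = 0 → x = 0) (y : Vec d) : 0 ≤ dualNorm N y := by
  simpa using inner_le_dualNorm hN (x := 0) (by simp) y

theorem dualNorm_zero (hN : ∀ x, N x = 0 → x = 0) : dualNorm N 0 = 0 := by
  obtain ⟨x, -, h⟩ := exists_inner_eq_dualNorm hN 0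
  simpa using h.symm

/-- Positive homogeneity of the dual norm, as the inequality that the ray argument uses. -/
theorem dualNorm_smul_le (hN : ∀ x, N x = 0 → x = 0) {c : ℝ} (hc : 0 ≤ c) (y : Vec d) :
    dualNorm N (c • y) ≤ c * dualNorm N y := by
  obtain ⟨x, hx, h⟩ := exists_inner_eq_dualNorm hN (c • y)
  rw [← h, real_inner_smul_right]
  exact mul_le_mul_of_nonneg_left (inner_le_dualNorm hN hx y) hc

/-- By the Hahn-Banach theorem, the dual of the dual norm is the norm, and the supremum that
defines it is attained. -/
theorem exists_norming (N : Seminorm ℝ (Vec d)) (x : Vec d) :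
    ∃ y : Vec d, dualNorm N y ≤ 1 ∧ inner ℝ x y = N x := by
  by_cases hx : x = 0
  · refine ⟨0, ?_, by simp [hx]⟩
    refine Real.sSup_le ?_ zero_le_one
    rintro _ ⟨x, -, rfl⟩
    simp
  obtain ⟨g, hg, hgN⟩ := exists_extension_of_le_sublinear
    (LinearPMap.mkSpanSingleton x (N x) hx) N
    (fun c hc x => by rw [map_smul_eq_mul, Real.norm_of_nonneg hc.le]) (map_add_le_add N) (by
      rintro ⟨z, hz⟩
      obtain ⟨c, rfl⟩ := Submodule.mem_span_singleton.1 hz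
      rw [LinearPMap.mkSpanSingleton'_apply, map_smul_eq_mul, smul_eq_mul]
      exact mul_le_mul_of_nonneg_right (le_abs_self c) (apply_nonneg N x))
  have key : ∀ z : Vec d,
      inner ℝ z ((InnerProductSpace.toDual ℝ (Vec d)).symm g.toContinuousLinearMap) = g z := by
    intro z
    rw [real_inner_comm, InnerProductSpace.toDual_symm_apply]
    rfl
  refine ⟨(InnerProductSpace.toDual ℝ (Vec d)).symm g.toContinuousLinearMap, ?_, ?_⟩
  · refine Real.sSup_le ?_ zero_le_one
    rintro _ ⟨z, hz, rfl⟩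
    simp only [key]
    exact (hgN z).trans hz
  · rw [key]
    exact (hg ⟨x, Submodule.mem_span_singleton_self x⟩).trans
      (LinearPMap.mkSpanSingleton_apply ℝ ℝ hx (N x))

end Duality

/-! ### Coordinate projections and orthant-strict monotonicity -/

section Projection

variable {d : ℕ} {K : Finset (Fin d)}

@[simp] theorem proj_apply (K : Finset (Fin d)) (x : Vec d) (i : Fin d) :
    proj K x i = if i ∈ K then x i else 0 := rfl

theorem mem_flat {x : Vec d} : x ∈ flat K ↔ ∀ i, i ∉ K → x i = 0 := Iff.rfl

theorem proj_mem_flat (K : Finset (Fin d)) (x : Vec d) : proj K x ∈ flat K := by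
  intro i hi
  simp [hi]

theorem proj_eq_self {x : Vec d} (hx : x ∈ flat K) : proj K x = x := by
  ext i
  by_cases hi : i ∈ K <;> simp [hi, mem_flat.1 hx]

theorem inner_proj_left (K : Finset (Fin d)) (x y : Vec d) :
    (inner ℝ (proj K x) y : ℝ) = inner ℝ x (proj K y) := by
  simp [PiLp.inner_apply]

theorem proj_proj_of_subset {J : Finset (Fin d)} (h : J ⊆ K) (x : Vec d) :
    proj J (proj K x) = proj J x := by
  ext i
  by_cases hi : i ∈ J <;> simp_all [@h i]

theorem mem_flat_supp (x : Vec d) : x ∈ flat (supp x) := by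
  intro i hi
  simpa [supp] using hi

theorem supp_subset {x : Vec d} (hx : x ∈ flat K) : supp x ⊆ K := by
  intro i hi
  by_contra h
  simp [supp, mem_flat.1 hx i h] at hi

theorem eq_zero_of_mem_flat_empty {x : Vec d} (hx : x ∈ flat ∅) : x = 0 := by
  ext i
  exact hx i (by simp)

/-- Erasing some of the nonzero coordinates strictly decreases an orthant-strictly monotonic
function. -/
theorem OrthantStrictlyMonotonic.proj_lt {M : Vec d → ℝ} (hM : OrthantStrictlyMonotonic M)
    {y : Vec d} (h : y ∉ flat K) : M (proj K y) < M y := by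
  simp only [mem_flat, not_forall] at h
  obtain ⟨j, hj, hy⟩ := h
  refine hM _ _ (fun i => ?_) ⟨j, ?_⟩ (fun i => ?_)
  · by_cases hi : i ∈ K <;> simp [hi]
  · simpa [hj] using hy
  · by_cases hi : i ∈ K <;> simp [hi, mul_self_nonneg]

theorem OrthantStrictlyMonotonic.proj_le {M : Vec d → ℝ} (hM : OrthantStrictlyMonotonic M)
    (K : Finset (Fin d)) (y : Vec d) : M (proj K y) ≤ M y := by
  by_cases h : y ∈ flat K
  · rw [proj_eq_self h]
  · exact (hM.proj_lt h).le

end Projection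

/-! ### The local norms under orthant-strict monotonicity -/

section LocalNorms

variable {d : ℕ} {N : Seminorm ℝ (Vec d)}

/-- Monotonicity of the dual norm makes `J = K` the best choice in the local-top-`K` dual norm. -/
theorem topDualNorm_eq (hD : OrthantStrictlyMonotonic (dualNorm N)) (K : Finset (Fin d))
    (y : Vec d) : topDualNorm N K y = dualNorm N (proj K y) := by
  refine le_antisymm (Finset.sup'_le _ _ fun J hJ => ?_) ?_
  · rw [← proj_proj_of_subset (Finset.mem_powerset.1 hJ)]
    exact hD.proj_le J _
  · exact Finset.le_sup' (fun J => dualNorm N (proj J y)) (Finset.mem_powerset_self K)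

/-- On `flat K`, the local-`K`-support dual norm is the source norm itself. -/
theorem supportDualNorm_eq (hN : ∀ x, N x = 0 → x = 0)
    (hD : OrthantStrictlyMonotonic (dualNorm N)) {K : Finset (Fin d)} {x : Vec d}
    (hx : x ∈ flat K) : supportDualNorm N K x = N x := by
  have hle : ∀ z ∈ (fun y : Vec d => inner ℝ y x) '' {y | y ∈ flat K ∧ topDualNorm N K y ≤ 1},
      z ≤ N x := by
    rintro _ ⟨y, ⟨hy, hy1⟩, rfl⟩
    rw [topDualNorm_eq hD, proj_eq_self hy] at hy1
    simp only [real_inner_comm x y]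
    exact (inner_le_mul_dualNorm hN x y).trans (mul_le_of_le_one_right (apply_nonneg N x) hy1)
  refine le_antisymm (Real.sSup_le hle (apply_nonneg N x)) ?_
  obtain ⟨y, hy1, hy⟩ := exists_norming N x
  refine le_csSup ⟨N x, hle⟩ ⟨proj K y, ⟨proj_mem_flat K y, ?_⟩, ?_⟩
  · rw [topDualNorm_eq hD, proj_eq_self (proj_mem_flat K y)]
    exact (hD.proj_le K y).trans hy1
  · simp only [inner_proj_left, proj_eq_self hx]
    rw [real_inner_comm, hy]

theorem mem_supportBall (hN : ∀ x, N x = 0 → x = 0)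
    (hD : OrthantStrictlyMonotonic (dualNorm N)) {K : Finset (Fin d)} {x : Vec d} :
    x ∈ supportBall N K ↔ x ∈ flat K ∧ N x ≤ 1 :=
  and_congr_right fun hx => by rw [supportDualNorm_eq hN hD hx]

theorem mem_supportSphere (hN : ∀ x, N x = 0 → x = 0)
    (hD : OrthantStrictlyMonotonic (dualNorm N)) {K : Finset (Fin d)} (hK : K.Nonempty)
    {x : Vec d} : x ∈ supportSphere N K ↔ x ∈ flat K ∧ N x = 1 := by
  rw [supportSphere, if_neg hK.ne_empty]
  exact and_congr_right fun hx => by rw [supportDualNorm_eq hN hD hx]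

theorem supportSphere_subset_supportBall (hN : ∀ x, N x = 0 → x = 0)
    (hD : OrthantStrictlyMonotonic (dualNorm N)) (K : Finset (Fin d)) :
    supportSphere N K ⊆ supportBall N K := by
  intro x hx
  rw [mem_supportBall hN hD]
  rcases K.eq_empty_or_nonempty with rfl | hK
  · obtain rfl : x = 0 := by simpa [supportSphere] using hx
    exact ⟨zero_mem _, by simp⟩
  · obtain ⟨h1, h2⟩ := (mem_supportSphere hN hD hK).1 hx
    exact ⟨h1, h2.le⟩

theorem supportSphere_nonempty (hN : ∀ x, N x = 0 → x = 0)
    (hD : OrthantStrictlyMonotonic (dualNorm N)) (K : Finset (Fin d)) :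
    (supportSphere N K).Nonempty := by
  rcases K.eq_empty_or_nonempty with rfl | hK
  · exact ⟨0, by simp [supportSphere]⟩
  obtain ⟨i, hi⟩ := hK
  have hne : N (EuclideanSpace.single i 1) ≠ 0 := fun h => by
    simpa using congrArg (fun x : Vec d => x i) (hN _ h)
  refine ⟨(N (EuclideanSpace.single i 1))⁻¹ • EuclideanSpace.single i 1,
    (mem_supportSphere hN hD ⟨i, hi⟩).2 ⟨Submodule.smul_mem _ _ ?_, ?_⟩⟩
  · intro j hj
    simp [ne_of_mem_of_not_mem hi hj |>.symm]
  · rw [map_smul_eq_mul, norm_inv, Real.norm_of_nonneg (apply_nonneg N _), inv_mul_cancel₀ hne]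

end LocalNorms

/-! ### The Capra-conjugate of `F ∘ supp` -/

section Conjugates

variable {d : ℕ} {N : Seminorm ℝ (Vec d)} {F : Finset (Fin d) → ℝ}

/-- The real-valued function `y ↦ max_K (‖y_K‖_⋆ - F K)`. Under the monotonicity hypotheses, it is
the Capra-conjugate of `F ∘ supp`. -/
noncomputable def capraConj (N : Seminorm ℝ (Vec d)) (F : Finset (Fin d) → ℝ) (y : Vec d) : ℝ :=
  Finset.univ.sup' Finset.univ_nonempty (fun K => dualNorm N (proj K y) - F K)

theorem le_capraConj (N : Seminorm ℝ (Vec d)) (F : Finset (Fin d) → ℝ) (K : Finset (Fin d))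
    (y : Vec d) : dualNorm N (proj K y) - F K ≤ capraConj N F y :=
  Finset.le_sup' (fun K => dualNorm N (proj K y) - F K) (Finset.mem_univ K)

theorem exists_capraConj_eq (N : Seminorm ℝ (Vec d)) (F : Finset (Fin d) → ℝ) (y : Vec d) :
    ∃ K, capraConj N F y = dualNorm N (proj K y) - F K := by
  obtain ⟨K, -, h⟩ := Finset.exists_mem_eq_sup' Finset.univ_nonempty
    (fun K => dualNorm N (proj K y) - F K)
  exact ⟨K, h⟩

theorem conjugate_capraCoupling (hN : ∀ x, N x = 0 → x = 0) (hmono : OrthantStrictlyMonotonic N)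
    (hF : Monotone F) (y : Vec d) :
    conjugate (capraCoupling N) (suppFun F) y = (capraConj N F y : EReal) := by
  refine le_antisymm (iSup_le fun x => ?_) ?_
  · by_cases hx : x = 0
    · rw [capraCoupling, if_pos hx, suppFun, ← EReal.coe_neg, zero_add, EReal.coe_le_coe_iff]
      have := le_capraConj N F (supp x) y
      have := dualNorm_nonneg hN (proj (supp x) y)
      linarith
    · rw [capraCoupling, if_neg hx, suppFun, ← EReal.coe_neg, ← EReal.coe_add,
        EReal.coe_le_coe_iff]
      have hpos : 0 < N x := lt_of_le_of_ne (apply_nonneg N x) fun h => hx (hN x h.symm)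
      have h1 := inner_le_mul_dualNorm hN x (proj (supp x) y)
      rw [← inner_proj_left, proj_eq_self (mem_flat_supp x)] at h1
      have h2 : inner ℝ x y / N x ≤ dualNorm N (proj (supp x) y) := by
        rwa [div_le_iff₀' hpos]
      have := le_capraConj N F (supp x) y
      linarith
  · obtain ⟨K, hK⟩ := exists_capraConj_eq N F y
    obtain ⟨x, hx1, hx⟩ := exists_inner_eq_dualNorm hN (proj K y)
    rw [← inner_proj_left] at hx
    have hsupp : F (supp (proj K x)) ≤ F K := hF (supp_subset (proj_mem_flat K x))
    refine le_trans ?_ (le_iSup _ (proj K x))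
    rw [hK, ← hx]
    by_cases h0 : proj K x = 0
    · rw [capraCoupling, if_pos h0, suppFun, ← EReal.coe_neg, zero_add, EReal.coe_le_coe_iff]
      rw [h0] at hsupp ⊢
      rw [inner_zero_left]
      linarith
    · rw [capraCoupling, if_neg h0, suppFun, ← EReal.coe_neg, ← EReal.coe_add,
        EReal.coe_le_coe_iff]
      have hpos : 0 < N (proj K x) :=
        lt_of_le_of_ne (apply_nonneg N _) fun h => h0 (hN _ h.symm)
      have hnn : (0 : ℝ) ≤ inner ℝ (proj K x) y := by
        rw [hx]
        exact dualNorm_nonneg hN _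
      have := le_div_self hnn hpos ((hmono.proj_le K x).trans hx1)
      linarith

theorem iSup_topDualNorm_sub (hD : OrthantStrictlyMonotonic (dualNorm N)) (y : Vec d) :
    (⨆ K, ((topDualNorm N K y - F K : ℝ) : EReal)) = (capraConj N F y : EReal) := by
  refine le_antisymm (iSup_le fun K => ?_) ?_
  · rw [topDualNorm_eq hD, EReal.coe_le_coe_iff]
    exact le_capraConj N F K y
  · obtain ⟨K, hK⟩ := exists_capraConj_eq N F y
    refine le_trans ?_ (le_iSup _ K)
    rw [hK, topDualNorm_eq hD]

theorem calL0_eq (hN : ∀ x, N x = 0 → x = 0) (hmono : OrthantStrictlyMonotonic N)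
    (hF : Monotone F) : calL0 N F = fenchelConj (fun y => (capraConj N F y : EReal)) :=
  congrArg fenchelConj (funext (conjugate_capraCoupling hN hmono hF))

theorem calL0_apply (hN : ∀ x, N x = 0 → x = 0) (hmono : OrthantStrictlyMonotonic N)
    (hF : Monotone F) (x : Vec d) :
    calL0 N F x = ⨆ y, ((inner ℝ x y - capraConj N F y : ℝ) : EReal) := by
  rw [calL0_eq hN hmono hF]
  refine iSup_congr fun y => ?_
  rw [fenchelCoupling, ← EReal.coe_neg, ← EReal.coe_add, real_inner_comm, sub_eq_add_neg]

theorem calL0_le_iff (hN : ∀ x, N x = 0 → x = 0) (hmono : OrthantStrictlyMonotonic N)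
    (hF : Monotone F) {x : Vec d} {r : ℝ} :
    calL0 N F x ≤ r ↔ ∀ y, inner ℝ x y - capraConj N F y ≤ r := by
  simp_rw [calL0_apply hN hmono hF, iSup_le_iff, EReal.coe_le_coe_iff]

theorem calL0_ne_bot (hN : ∀ x, N x = 0 → x = 0) (hmono : OrthantStrictlyMonotonic N)
    (hF : Monotone F) (x : Vec d) : calL0 N F x ≠ ⊥ := by
  rw [calL0_apply hN hmono hF]
  exact ne_bot_of_le_ne_bot (EReal.coe_ne_bot (inner ℝ x 0 - capraConj N F 0))
    (le_iSup (fun y : Vec d => ((inner ℝ x y - capraConj N F y : ℝ) : EReal)) 0)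

theorem lowerSemicontinuous_calL0 (hN : ∀ x, N x = 0 → x = 0)
    (hmono : OrthantStrictlyMonotonic N) (hF : Monotone F) : LowerSemicontinuous (calL0 N F) := by
  rw [funext (calL0_apply hN hmono hF)]
  exact lowerSemicontinuous_iSup fun y => Continuous.lowerSemicontinuous
    (continuous_coe_real_ereal.comp (by fun_prop))

theorem convex_epigraph_calL0 (hN : ∀ x, N x = 0 → x = 0)
    (hmono : OrthantStrictlyMonotonic N) (hF : Monotone F) :
    Convex ℝ {p : Vec d × ℝ | calL0 N F p.1 ≤ (p.2 : EReal)} := by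
  simp_rw [calL0_le_iff hN hmono hF]
  intro p hp q hq a b ha hb hab y
  have h1 := mul_le_mul_of_nonneg_left (hp y) ha
  have h2 := mul_le_mul_of_nonneg_left (hq y) hb
  simp only [Prod.fst_add, Prod.snd_add, Prod.smul_fst, Prod.smul_snd, smul_eq_mul,
    inner_add_left, real_inner_smul_left]
  linear_combination h1 + h2 + capraConj N F y * hab

/-- `calL0` is infinite outside of the unit ball of the source norm: its affine minorants along
the ray of a norming `y` have slopes `N x - 1`. -/
theorem seminorm_le_one_of_calL0_lt_top (hN : ∀ x, N x = 0 → x = 0)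
    (hmono : OrthantStrictlyMonotonic N) (hD : OrthantStrictlyMonotonic (dualNorm N))
    (hF : Monotone F) {x : Vec d} (hx : calL0 N F x < ⊤) : N x ≤ 1 := by
  by_contra! h1
  obtain ⟨r, hr⟩ : ∃ r : ℝ, calL0 N F x ≤ r :=
    ⟨(calL0 N F x).toReal, EReal.le_coe_toReal hx.ne⟩
  rw [calL0_le_iff hN hmono hF] at hr
  obtain ⟨y, hy1, hy⟩ := exists_norming N x
  have key : ∀ c : ℝ, 0 ≤ c → c * (N x - 1) ≤ r - F ∅ := by
    intro c hc
    have h2 := hr (c • y)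
    obtain ⟨K, hK⟩ := exists_capraConj_eq N F (c • y)
    have h3 := hD.proj_le K (c • y)
    have h4 := dualNorm_smul_le hN hc y
    have h5 := mul_le_mul_of_nonneg_left hy1 hc
    have h6 : F ∅ ≤ F K := hF (Finset.empty_subset K)
    rw [real_inner_smul_right, hy] at h2
    linarith
  have h2 := key ((|r - F ∅| + 1) / (N x - 1)) (div_nonneg (by positivity) (by linarith))
  rw [div_mul_cancel₀ _ (by linarith)] at h2
  linarith [le_abs_self (r - F ∅)]

end Conjugates

/-! ### Decompositions along the flats, and the duality theorem -/

section Decompositions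

variable {d : ℕ} {N : Seminorm ℝ (Vec d)} {F : Finset (Fin d) → ℝ}

/-- The pairs `(μ, w)` of weights in the simplex and of families of vectors `w K ∈ flat K` with
`N (w K) ≤ μ K`. Keeping `w K`, rather than the vector `w K / μ K` of the unit ball, makes this set
convex. -/
def weightedBalls (N : Seminorm ℝ (Vec d)) :
    Set ((Finset (Fin d) → ℝ) × (Finset (Fin d) → Vec d)) :=
  {p | p.1 ∈ stdSimplex ℝ (Finset (Fin d)) ∧ ∀ K, p.2 K ∈ flat K ∧ N (p.2 K) ≤ p.1 K}

theorem convex_weightedBalls (N : Seminorm ℝ (Vec d)) : Convex ℝ (weightedBalls N) := by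
  intro p hp q hq a b ha hb hab
  refine ⟨convex_stdSimplex ℝ _ hp.1 hq.1 ha hb hab, fun K => ⟨?_, ?_⟩⟩
  · exact add_mem (Submodule.smul_mem _ _ (hp.2 K).1) (Submodule.smul_mem _ _ (hq.2 K).1)
  · refine (map_add_le_add N _ _).trans (add_le_add ?_ ?_)
    · simp only [Pi.smul_apply, map_smul_eq_mul, Real.norm_of_nonneg ha, Prod.smul_fst,
        Prod.smul_snd, smul_eq_mul]
      exact mul_le_mul_of_nonneg_left (hp.2 K).2 ha
    · simp only [Pi.smul_apply, map_smul_eq_mul, Real.norm_of_nonneg hb, Prod.smul_fst,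
        Prod.smul_snd, smul_eq_mul]
      exact mul_le_mul_of_nonneg_left (hq.2 K).2 hb

theorem isCompact_weightedBalls (hN : ∀ x, N x = 0 → x = 0) : IsCompact (weightedBalls N) := by
  have hflat : ∀ K : Finset (Fin d), IsClosed (flat K : Set (Vec d)) :=
    fun K => Submodule.closed_of_finiteDimensional _
  have hNc := continuous_seminorm N
  refine ((isCompact_stdSimplex ℝ (Finset (Fin d))).prod
    (isCompact_univ_pi fun _ : Finset (Fin d) => isCompact_unitBall hN)).of_isClosed_subset ?_ ?_
  · have : weightedBalls N = {p | p.1 ∈ stdSimplex ℝ (Finset (Fin d))} ∩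
        ⋂ K, ({p | p.2 K ∈ (flat K : Set (Vec d))} ∩ {p | N (p.2 K) ≤ p.1 K}) := by
      ext p
      simp [weightedBalls]
    rw [this]
    refine ((isClosed_stdSimplex ℝ (Finset (Fin d))).preimage continuous_fst).inter
      (isClosed_iInter fun K => ((hflat K).preimage (by fun_prop)).inter
        (isClosed_le (by fun_prop) (by fun_prop)))
  · exact fun p hp => ⟨hp.1, fun K _ => (hp.2 K).2.trans (mem_Icc_of_mem_stdSimplex hp.1 K).2⟩

theorem single_mem_weightedBalls {K : Finset (Fin d)} {x : Vec d} (hx : x ∈ flat K)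
    (h1 : N x ≤ 1) : (Pi.single K 1, Pi.single K x) ∈ weightedBalls N := by
  refine ⟨single_mem_stdSimplex ℝ K, fun J => ?_⟩
  rcases eq_or_ne J K with rfl | h
  · simpa using ⟨hx, h1⟩
  · simp [h]

/-- The easy half of the duality: a decomposition of `x` gives an upper bound on `calL0`. -/
theorem calL0_le_of_mem_weightedBalls (hN : ∀ x, N x = 0 → x = 0)
    (hmono : OrthantStrictlyMonotonic N) (hF : Monotone F)
    {p : (Finset (Fin d) → ℝ) × (Finset (Fin d) → Vec d)} (hp : p ∈ weightedBalls N) :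
    calL0 N F (∑ K, p.2 K) ≤ ((∑ K, p.1 K * F K : ℝ) : EReal) := by
  rw [calL0_le_iff hN hmono hF]
  intro y
  have h : ∀ K ∈ Finset.univ, inner ℝ (p.2 K) y ≤ p.1 K * (capraConj N F y + F K) := by
    intro K _
    calc (inner ℝ (p.2 K) y : ℝ) = inner ℝ (p.2 K) (proj K y) := by
          rw [← inner_proj_left, proj_eq_self (hp.2 K).1]
      _ ≤ N (p.2 K) * dualNorm N (proj K y) := inner_le_mul_dualNorm hN _ _
      _ ≤ p.1 K * dualNorm N (proj K y) :=
          mul_le_mul_of_nonneg_right (hp.2 K).2 (dualNorm_nonneg hN _)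
      _ ≤ _ := by
          have := le_capraConj N F K y
          exact mul_le_mul_of_nonneg_left (by linarith) (hp.1.1 K)
  have h2 := Finset.sum_le_sum h
  simp only [mul_add, Finset.sum_add_distrib] at h2
  rw [← Finset.sum_mul, hp.1.2, one_mul] at h2
  rw [sum_inner]
  linarith

theorem calL0_le_of_mem (hN : ∀ x, N x = 0 → x = 0)
    (hmono : OrthantStrictlyMonotonic N) (hF : Monotone F) {K : Finset (Fin d)} {x : Vec d}
    (hx : x ∈ flat K) (h1 : N x ≤ 1) : calL0 N F x ≤ (F K : EReal) := by
  have h := calL0_le_of_mem_weightedBalls hN hmono hF (single_mem_weightedBalls hx h1)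
  simpa [Finset.sum_pi_single', Pi.single_apply] using h

/-- The hard half of the duality: a finite value of `calL0` is attained by a decomposition. If
every decomposition of `x` cost more than `calL0 N F x`, a hyperplane of `ℝ^d × ℝ` would separate
`(x, calL0 N F x)` from the compact convex set of the pairs `(∑ w K, ∑ μ K * F K)`. -/
theorem exists_mem_weightedBalls (hN : ∀ x, N x = 0 → x = 0)
    (hmono : OrthantStrictlyMonotonic N) (hD : OrthantStrictlyMonotonic (dualNorm N))
    (hF : Monotone F) {x : Vec d} (hx : calL0 N F x < ⊤) :
    ∃ p ∈ weightedBalls N, ∑ K, p.2 K = x ∧ ((∑ K, p.1 K * F K : ℝ) : EReal) ≤ calL0 N F x := by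
  have hx1 := seminorm_le_one_of_calL0_lt_top hN hmono hD hF hx
  lift calL0 N F x to ℝ using ⟨hx.ne, calL0_ne_bot hN hmono hF x⟩ with t ht
  simp only [EReal.coe_le_coe_iff]
  have htle := (calL0_le_iff hN hmono hF).1 ht.symm.le
  let T : (Finset (Fin d) → ℝ) × (Finset (Fin d) → Vec d) → Vec d × ℝ :=
    fun p => (∑ K, p.2 K, ∑ K, p.1 K * F K)
  have hTlin : IsLinearMap ℝ T := by
    constructor
    · intro p q
      simp [T, Finset.sum_add_distrib, add_mul]
    · intro c p
      simp [T, Finset.smul_sum, Finset.mul_sum, mul_assoc]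
  have hTcont : Continuous T := by fun_prop
  have hxV : (x, F Finset.univ) ∈ T '' weightedBalls N :=
    ⟨_, single_mem_weightedBalls (K := Finset.univ) (x := x) (fun i hi => by simp at hi) hx1,
      by simp [T, Pi.single_apply]⟩
  by_contra! hcon
  have hnot : (x, t) ∉ T '' weightedBalls N := by
    rintro ⟨p, hp, hpT⟩
    have := hcon p hp (congrArg Prod.fst hpT)
    exact this.ne' (congrArg Prod.snd hpT)
  obtain ⟨f, u, hfu, huf⟩ := geometric_hahn_banach_closed_point
    ((convex_weightedBalls N).is_linear_image hTlin)
    ((isCompact_weightedBalls hN).image hTcont).isClosed hnot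
  set y := (InnerProductSpace.toDual ℝ (Vec d)).symm (f.comp (ContinuousLinearMap.inl ℝ _ _))
    with hy
  set s := f (0, 1) with hs
  have hf : ∀ (v : Vec d) (r : ℝ), f (v, r) = inner ℝ v y + r * s := by
    intro v r
    have h1 : (v, r) = (v, (0 : ℝ)) + r • ((0 : Vec d), (1 : ℝ)) := by simp
    rw [h1, map_add, map_smul, smul_eq_mul, hy, real_inner_comm,
      InnerProductSpace.toDual_symm_apply]
    rfl
  have hlt : t < F Finset.univ := by
    obtain ⟨p, hp, hpT⟩ := hxV
    have h1 := hcon p hp (congrArg Prod.fst hpT)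
    have h2 : ∑ K, p.1 K * F K = F Finset.univ := congrArg Prod.snd hpT
    linarith
  -- The separating hyperplane is not vertical, as `(x, F univ)` lies above `(x, t)`.
  have hs0 : s < 0 := by
    have h1 := (hfu _ hxV).trans huf
    rw [hf, hf] at h1
    nlinarith
  -- Rescaling the normal to `((-s)⁻¹ • y, -1)` gives a slope for which the affine minorant
  -- `⟨·, (-s)⁻¹ • y⟩ - capraConj N F ((-s)⁻¹ • y)` of `calL0 N F` exceeds `t` at `x`.
  obtain ⟨K, hK⟩ := exists_capraConj_eq N F ((-s)⁻¹ • y)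
  obtain ⟨b, hb1, hb⟩ := exists_inner_eq_dualNorm hN (proj K ((-s)⁻¹ • y))
  rw [← inner_proj_left] at hb
  have hmem : (proj K b, F K) ∈ T '' weightedBalls N :=
    ⟨_, single_mem_weightedBalls (proj_mem_flat K b) ((hmono.proj_le K b).trans hb1),
      by simp [T, Pi.single_apply]⟩
  have h1 := (hfu _ hmem).trans huf
  rw [hf, hf] at h1
  have h2 := htle ((-s)⁻¹ • y)
  rw [hK, ← hb, real_inner_smul_right, real_inner_smul_right] at h2
  have h3 : (-s) * ((-s)⁻¹ * inner ℝ x y - ((-s)⁻¹ * inner ℝ (proj K b) y - F K)) ≤ -s * t :=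
    mul_le_mul_of_nonneg_left h2 (by linarith)
  have h4 : (-s) * (-s)⁻¹ = 1 := mul_inv_cancel₀ (by linarith)
  have h5 : (-s) * ((-s)⁻¹ * inner ℝ x y - ((-s)⁻¹ * inner ℝ (proj K b) y - F K)) =
      inner ℝ x y - inner ℝ (proj K b) y - s * F K := by
    linear_combination (inner ℝ x y - inner ℝ (proj K b) y) * h4
  linarith

end Decompositions

/-! ### Decompositions along the spheres -/

section TightDecompositions

variable {d : ℕ} {N : Seminorm ℝ (Vec d)} {F : Finset (Fin d) → ℝ}

theorem sum_eq_add_sum_nonempty {M : Type*} [AddCommMonoid M] (f : Finset (Fin d) → M) :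
    ∑ K, f K = f ∅ + ∑ K : {K : Finset (Fin d) // K.Nonempty}, f K.1 := by
  rw [← Finset.add_sum_erase _ _ (Finset.mem_univ ∅),
    Finset.sum_subtype (Finset.univ.erase ∅) (p := fun K => K.Nonempty)]
  simp [Finset.nonempty_iff_ne_empty]

/-- The smallest weights that a family `w` allows on the nonempty sets, the rest of the mass being
put on the empty set. -/
noncomputable def tightWeights (N : Seminorm ℝ (Vec d)) (w : Finset (Fin d) → Vec d)
    (K : Finset (Fin d)) : ℝ :=
  if K.Nonempty then N (w K) else 1 - ∑ J : {K : Finset (Fin d) // K.Nonempty}, N (w J.1)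

theorem sum_tightWeights_mul (N : Seminorm ℝ (Vec d)) (w : Finset (Fin d) → Vec d)
    (F : Finset (Fin d) → ℝ) :
    ∑ K, tightWeights N w K * F K =
      (1 - ∑ K : {K : Finset (Fin d) // K.Nonempty}, N (w K.1)) * F ∅ +
        ∑ K : {K : Finset (Fin d) // K.Nonempty}, N (w K.1) * F K.1 := by
  rw [sum_eq_add_sum_nonempty]
  refine congrArg₂ (· + ·) (by simp [tightWeights]) (Finset.sum_congr rfl fun K _ => ?_)
  rw [tightWeights, if_pos K.2]

theorem tightWeights_mem {w : Finset (Fin d) → Vec d} (hw : ∀ K, w K ∈ flat K)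
    (h1 : ∑ K : {K : Finset (Fin d) // K.Nonempty}, N (w K.1) ≤ 1) :
    (tightWeights N w, w) ∈ weightedBalls N := by
  refine ⟨⟨fun K => ?_, ?_⟩, fun K => ⟨hw K, ?_⟩⟩
  · dsimp only [tightWeights]
    split_ifs
    · exact apply_nonneg N _
    · linarith
  · simpa using sum_tightWeights_mul N w 1
  · rcases K.eq_empty_or_nonempty with rfl | hK
    · simpa [eq_zero_of_mem_flat_empty (hw ∅), tightWeights] using h1
    · exact (if_pos hK).ge

theorem sum_seminorm_le_one {p : (Finset (Fin d) → ℝ) × (Finset (Fin d) → Vec d)}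
    (hp : p ∈ weightedBalls N) :
    ∑ K : {K : Finset (Fin d) // K.Nonempty}, N (p.2 K.1) ≤ 1 := by
  have h1 := sum_eq_add_sum_nonempty p.1
  rw [hp.1.2] at h1
  have h2 : ∑ K : {K : Finset (Fin d) // K.Nonempty}, N (p.2 K.1) ≤
      ∑ K : {K : Finset (Fin d) // K.Nonempty}, p.1 K.1 :=
    Finset.sum_le_sum fun K _ => (hp.2 K.1).2
  linarith [hp.1.1 ∅]

/-- Moving mass to the empty set, where `F` is smallest, does not increase the cost. -/
theorem sum_tightWeights_mul_le (hF : Monotone F)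
    {p : (Finset (Fin d) → ℝ) × (Finset (Fin d) → Vec d)} (hp : p ∈ weightedBalls N) :
    ∑ K, tightWeights N p.2 K * F K ≤ ∑ K, p.1 K * F K := by
  have h1 := sum_eq_add_sum_nonempty p.1
  rw [hp.1.2] at h1
  have h2 : 0 ≤ ∑ K : {K : Finset (Fin d) // K.Nonempty},
      (p.1 K.1 - N (p.2 K.1)) * (F K.1 - F ∅) :=
    Finset.sum_nonneg fun K _ => mul_nonneg (sub_nonneg.2 (hp.2 K.1).2)
      (sub_nonneg.2 (hF (Finset.empty_subset _)))
  rw [sum_tightWeights_mul, sum_eq_add_sum_nonempty]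
  simp only [sub_mul, mul_sub, Finset.sum_sub_distrib, ← Finset.sum_mul] at h2
  linear_combination h2 + F ∅ * h1

theorem mem_tightWeights_smul_supportSphere (hN : ∀ x, N x = 0 → x = 0)
    (hD : OrthantStrictlyMonotonic (dualNorm N)) {w : Finset (Fin d) → Vec d}
    (hw : ∀ K, w K ∈ flat K) (K : Finset (Fin d)) :
    w K ∈ tightWeights N w K • supportSphere N K := by
  by_cases h0 : w K = 0
  · obtain ⟨s, hs⟩ := supportSphere_nonempty hN hD K
    rcases K.eq_empty_or_nonempty with rfl | hK
    · exact ⟨0, by simp [supportSphere], by simp [h0]⟩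
    · exact ⟨s, hs, by simp [tightWeights, hK, h0]⟩
  · have hK : K.Nonempty := by
      rw [Finset.nonempty_iff_ne_empty]
      rintro rfl
      exact h0 (eq_zero_of_mem_flat_empty (hw ∅))
    have hne : N (w K) ≠ 0 := fun h => h0 (hN _ h)
    rw [tightWeights, if_pos hK]
    refine ⟨(N (w K))⁻¹ • w K, (mem_supportSphere hN hD hK).2
      ⟨Submodule.smul_mem _ _ (hw K), ?_⟩, smul_inv_smul₀ hne _⟩
    rw [map_smul_eq_mul, norm_inv, Real.norm_of_nonneg (apply_nonneg N _), inv_mul_cancel₀ hne]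

theorem exists_tight_decomposition (hN : ∀ x, N x = 0 → x = 0)
    (hmono : OrthantStrictlyMonotonic N) (hD : OrthantStrictlyMonotonic (dualNorm N))
    (hF : Monotone F) {x : Vec d} (hx : calL0 N F x < ⊤) :
    ∃ w : Finset (Fin d) → Vec d, (∀ K, w K ∈ flat K) ∧ ∑ K, w K = x ∧
      (tightWeights N w, w) ∈ weightedBalls N ∧
      ((∑ K, tightWeights N w K * F K : ℝ) : EReal) ≤ calL0 N F x := by
  obtain ⟨p, hp, hpx, hle⟩ := exists_mem_weightedBalls hN hmono hD hF hx
  have hflat := fun K => (hp.2 K).1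
  exact ⟨p.2, hflat, hpx, tightWeights_mem hflat (sum_seminorm_le_one hp),
    (EReal.coe_le_coe_iff.2 (sum_tightWeights_mul_le hF hp)).trans hle⟩

end TightDecompositions

/-! ### Variational expressions -/

section Variational

variable {d : ℕ} {N : Seminorm ℝ (Vec d)} {F : Finset (Fin d) → ℝ}

theorem isMinOver_of_le_of_exists {α : Type*} {m : EReal} {S : Set α} {φ : α → ℝ}
    (h1 : ∀ a ∈ S, m ≤ (φ a : EReal)) (h2 : m < ⊤ → ∃ a ∈ S, (φ a : EReal) ≤ m) :
    IsMinOver m S φ := by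
  refine ⟨le_antisymm (le_iInf₂ h1) ?_, ?_⟩
  · rcases eq_top_or_lt_top m with h | h
    · simp [h]
    · obtain ⟨a, ha, hle⟩ := h2 h
      exact (iInf₂_le a ha).trans hle
  · rintro ⟨a, ha⟩
    obtain ⟨b, hb, hle⟩ := h2 ((h1 a ha).trans_lt (EReal.coe_lt_top _))
    exact ⟨b, hb, le_antisymm hle (h1 b hb)⟩

theorem isMinOver_feasibleWeights (hN : ∀ x, N x = 0 → x = 0)
    (hmono : OrthantStrictlyMonotonic N) (hD : OrthantStrictlyMonotonic (dualNorm N))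
    (hF : Monotone F) {Γ : Finset (Fin d) → Set (Vec d)}
    (hS : ∀ K, supportSphere N K ⊆ Γ K) (hB : ∀ K, Γ K ⊆ supportBall N K) (x : Vec d) :
    IsMinOver (calL0 N F x) (feasibleWeights Γ x) (fun μ => ∑ K, μ K * F K) := by
  refine isMinOver_of_le_of_exists ?_ fun hx => ?_
  · rintro μ ⟨hμ, hxμ⟩
    obtain ⟨w, hw, rfl⟩ := (Set.mem_fintype_sum _ _).1 hxμ
    refine calL0_le_of_mem_weightedBalls hN hmono hF (p := (μ, w)) ⟨hμ, fun K => ?_⟩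
    obtain ⟨b, hb, hbw⟩ := hw (i := K)
    obtain ⟨hb1, hb2⟩ := (mem_supportBall hN hD).1 (hB K hb)
    simp only [← hbw]
    refine ⟨Submodule.smul_mem _ _ hb1, ?_⟩
    rw [map_smul_eq_mul, Real.norm_of_nonneg (hμ.1 K)]
    exact mul_le_of_le_one_right (hμ.1 K) hb2
  · obtain ⟨w, hw, hwx, hmem, hle⟩ := exists_tight_decomposition hN hmono hD hF hx
    refine ⟨tightWeights N w, ⟨hmem.1, (Set.mem_fintype_sum _ _).2 ⟨w, fun {K} => ?_, hwx⟩⟩, hle⟩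
    exact Set.smul_set_mono (hS K) (mem_tightWeights_smul_supportSphere hN hD hw K)

theorem isMinOver_feasibleDecompositions (hN : ∀ x, N x = 0 → x = 0)
    (hmono : OrthantStrictlyMonotonic N) (hD : OrthantStrictlyMonotonic (dualNorm N))
    (hF : Monotone F) (hF0 : F ∅ = 0) (x : Vec d) :
    IsMinOver (calL0 N F x) (feasibleDecompositions N x)
      (fun z => ∑ K, supportDualNorm N K.1 (z K) * F K.1) := by
  refine isMinOver_of_le_of_exists ?_ fun hx => ?_
  · rintro z ⟨hz, hz1, rfl⟩
    let w : Finset (Fin d) → Vec d := fun K => if h : K.Nonempty then z ⟨K, h⟩ else 0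
    have hwz : ∀ K : {K : Finset (Fin d) // K.Nonempty}, w K.1 = z K := fun K => dif_pos K.2
    have hwe : w ∅ = 0 := dif_neg (by simp)
    have hw : ∀ K, w K ∈ flat K := by
      intro K
      rcases K.eq_empty_or_nonempty with rfl | hK
      · rw [hwe]
        exact zero_mem _
      · exact hwz ⟨K, hK⟩ ▸ hz ⟨K, hK⟩
    have hzN : ∀ K, supportDualNorm N K.1 (z K) = N (w K.1) := fun K => by
      rw [supportDualNorm_eq hN hD (hz K), hwz]
    simp only [hzN] at hz1 ⊢
    have h := calL0_le_of_mem_weightedBalls hN hmono hF (tightWeights_mem hw hz1)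
    rw [sum_tightWeights_mul, hF0, mul_zero, zero_add, sum_eq_add_sum_nonempty] at h
    simpa only [hwe, zero_add, hwz] using h
  · obtain ⟨w, hw, hwx, hmem, hle⟩ := exists_tight_decomposition hN hmono hD hF hx
    have hzN : ∀ K : {K : Finset (Fin d) // K.Nonempty},
        supportDualNorm N K.1 (w K.1) = N (w K.1) := fun K => supportDualNorm_eq hN hD (hw K.1)
    refine ⟨fun K => w K.1, ⟨fun K => hw K.1, ?_, ?_⟩, ?_⟩
    · simp only [hzN]
      exact sum_seminorm_le_one hmem
    · rw [← hwx, sum_eq_add_sum_nonempty w, eq_zero_of_mem_flat_empty (hw ∅), zero_add]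
    · rw [sum_tightWeights_mul, hF0, mul_zero, zero_add] at hle
      simpa only [hzN] using hle

end Variational

/-! ### Hidden convexity -/

section HiddenConvexity

variable {d : ℕ} {N : Seminorm ℝ (Vec d)} {F : Finset (Fin d) → ℝ}

/-- In any decomposition of a unit vector `x`, every set of positive weight contains the support of
`x`. Let `y` be a norming vector of `x`. Each term of positive weight has to be normed by `y` as
well, so that `‖y_K‖_⋆ = ‖y‖_⋆` and, by strict monotonicity of the dual norm, `supp y ⊆ K`; and
`supp x ⊆ supp y` by strict monotonicity of the norm. -/
theorem mem_flat_of_weight_pos (hN : ∀ x, N x = 0 → x = 0)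
    (hmono : OrthantStrictlyMonotonic N) (hD : OrthantStrictlyMonotonic (dualNorm N))
    {p : (Finset (Fin d) → ℝ) × (Finset (Fin d) → Vec d)} (hp : p ∈ weightedBalls N)
    (hx : N (∑ K, p.2 K) = 1) {K : Finset (Fin d)} (hK : 0 < p.1 K) :
    ∑ J, p.2 J ∈ flat K := by
  set x := ∑ J, p.2 J with hxdef
  obtain ⟨y, hy1, hy⟩ := exists_norming N x
  rw [hx] at hy
  have hterm : ∀ J, inner ℝ (p.2 J) y ≤ p.1 J * dualNorm N (proj J y) := fun J => by
    rw [← proj_eq_self (hp.2 J).1, inner_proj_left]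
    refine (inner_le_mul_dualNorm hN _ _).trans ?_
    exact mul_le_mul_of_nonneg_right (hp.2 J).2 (dualNorm_nonneg hN _)
  have hyK : y ∈ flat K := by
    by_contra h
    have hlt : dualNorm N (proj K y) < 1 := (hD.proj_lt h).trans_le hy1
    have hsum : ∑ J, (inner ℝ (p.2 J) y : ℝ) < ∑ J, p.1 J := by
      refine Finset.sum_lt_sum (fun J _ => (hterm J).trans ?_) ⟨K, Finset.mem_univ K,
        (hterm K).trans_lt ?_⟩
      · exact mul_le_of_le_one_right (hp.1.1 J) ((hD.proj_le J y).trans hy1)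
      · exact mul_lt_of_lt_one_right hK hlt
    rw [← sum_inner, ← hxdef, hy, hp.1.2] at hsum
    exact lt_irrefl _ hsum
  by_contra h
  have h1 := hmono.proj_lt h
  have h2 := inner_le_mul_dualNorm hN (proj K x) y
  rw [inner_proj_left, proj_eq_self hyK, hy] at h2
  have h3 := mul_le_of_le_one_right (apply_nonneg N (proj K x)) hy1
  linarith

theorem calL0_eq_of_seminorm_eq_one (hN : ∀ x, N x = 0 → x = 0)
    (hmono : OrthantStrictlyMonotonic N) (hD : OrthantStrictlyMonotonic (dualNorm N))
    (hF : Monotone F) {x : Vec d} (hx : N x = 1) : (F (supp x) : EReal) = calL0 N F x := by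
  have hle := calL0_le_of_mem hN hmono hF (mem_flat_supp x) hx.le
  refine le_antisymm ?_ hle
  obtain ⟨p, hp, rfl, hpF⟩ := exists_mem_weightedBalls hN hmono hD hF
    (hle.trans_lt (EReal.coe_lt_top _))
  refine le_trans (EReal.coe_le_coe_iff.2 ?_) hpF
  rw [← one_mul (F _), ← hp.1.2, Finset.sum_mul]
  refine Finset.sum_le_sum fun K _ => ?_
  rcases (hp.1.1 K).eq_or_lt with h | h
  · simp [← h]
  · exact mul_le_mul_of_nonneg_left
      (hF (supp_subset (mem_flat_of_weight_pos hN hmono hD hp hx h))) h.le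

theorem calL0_zero (hN : ∀ x, N x = 0 → x = 0)
    (hmono : OrthantStrictlyMonotonic N) (hF : Monotone F) :
    calL0 N F 0 = (F ∅ : EReal) := by
  refine le_antisymm (calL0_le_of_mem hN hmono hF (zero_mem _) (by simp)) ?_
  rw [calL0_apply hN hmono hF]
  refine le_trans (EReal.coe_le_coe_iff.2 ?_)
    (le_iSup (fun y : Vec d => ((inner ℝ 0 y - capraConj N F y : ℝ) : EReal)) 0)
  obtain ⟨K, hK⟩ := exists_capraConj_eq N F 0
  have h0 : proj K (0 : Vec d) = 0 := proj_eq_self (zero_mem _)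
  rw [hK, h0, dualNorm_zero hN, inner_zero_left]
  have : F ∅ ≤ F K := hF (Finset.empty_subset K)
  linarith

theorem supp_smul {c : ℝ} (hc : c ≠ 0) (x : Vec d) : supp (c • x) = supp x := by
  ext i
  simp [supp, hc]

theorem calL0_inv_smul (hN : ∀ x, N x = 0 → x = 0)
    (hmono : OrthantStrictlyMonotonic N) (hD : OrthantStrictlyMonotonic (dualNorm N))
    (hF : Monotone F) {x : Vec d} (hx : x ≠ 0) :
    (F (supp x) : EReal) = calL0 N F ((N x)⁻¹ • x) := by
  have hne : N x ≠ 0 := fun h => hx (hN x h)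
  rw [← supp_smul (inv_ne_zero hne) x]
  refine calL0_eq_of_seminorm_eq_one hN hmono hD hF ?_
  rw [map_smul_eq_mul, norm_inv, Real.norm_of_nonneg (apply_nonneg N _), inv_mul_cancel₀ hne]

end HiddenConvexity

/-! ### Largest proper convex lower semicontinuous minorants -/

section Minorants

variable {d : ℕ} {N : Seminorm ℝ (Vec d)} {F : Finset (Fin d) → ℝ}

theorem properConvexLsc_calL0 (hN : ∀ x, N x = 0 → x = 0)
    (hmono : OrthantStrictlyMonotonic N) (hF : Monotone F) : ProperConvexLsc (calL0 N F) :=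
  ⟨⟨calL0_ne_bot hN hmono hF, 0, by rw [calL0_zero hN hmono hF]; exact EReal.coe_lt_top _⟩,
    convex_epigraph_calL0 hN hmono hF, lowerSemicontinuous_calL0 hN hmono hF⟩

theorem infCharFun_eq_sInf (Γ : Finset (Fin d) → Set (Vec d)) (F : Finset (Fin d) → ℝ) :
    infCharFun Γ F = fun x => sInf ((fun K => (F K : EReal)) '' {K | x ∈ Γ K}) := by
  ext x
  rw [sInf_image]
  refine iInf_congr fun K => ?_
  by_cases h : x ∈ Γ K <;> simp [charFun, h]

/-- A convex minorant satisfies the Jensen inequality along the decomposition of `x` into spheres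
that attains `calL0 N F x`. -/
theorem isLargest_calL0 (hN : ∀ x, N x = 0 → x = 0)
    (hmono : OrthantStrictlyMonotonic N) (hD : OrthantStrictlyMonotonic (dualNorm N))
    (hF : Monotone F) {Γ : Finset (Fin d) → Set (Vec d)}
    (hS : ∀ K, supportSphere N K ⊆ Γ K) (hB : ∀ K, Γ K ⊆ supportBall N K) :
    IsLargestProperConvexLscBelow (calL0 N F) (infCharFun Γ F) := by
  refine ⟨⟨properConvexLsc_calL0 hN hmono hF, fun x => le_iInf fun K => ?_⟩, ?_⟩
  · by_cases hx : x ∈ Γ K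
    · obtain ⟨h1, h2⟩ := (mem_supportBall hN hD).1 (hB K hx)
      simpa [charFun, hx] using calL0_le_of_mem hN hmono hF h1 h2
    · simp [charFun, hx]
  · rintro h ⟨⟨-, hconv, -⟩, hle⟩ x
    rcases eq_top_or_lt_top (calL0 N F x) with hx | hx
    · simp [hx]
    obtain ⟨w, hw, hwx, hmem, hleL⟩ := exists_tight_decomposition hN hmono hD hF hx
    choose s hs hsw using mem_tightWeights_smul_supportSphere hN hD hw
    have hepi : ∀ K ∈ Finset.univ, (s K, F K) ∈ {p : Vec d × ℝ | h p.1 ≤ (p.2 : EReal)} := by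
      intro K _
      refine (hle (s K)).trans ((iInf_le _ K).trans ?_)
      simp [charFun, hS K (hs K)]
    have h1 := hconv.sum_mem (fun K _ => hmem.1.1 K) hmem.1.2 hepi
    simp only [Prod.smul_mk, smul_eq_mul, Set.mem_ofPred_eq, Prod.fst_sum, Prod.snd_sum] at h1
    have hsw' : ∀ K, tightWeights N w K • s K = w K := hsw
    rw [Finset.sum_congr rfl fun K _ => hsw' K, hwx] at h1
    exact h1.trans hleL

end Minorants

end Capra

theorem mainTheorem2 (d : ℕ) (hd : 1 ≤ d)
    (N : Seminorm ℝ (Vec d)) (hN : ∀ x, N x = 0 → x = 0)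
    (hmono : OrthantStrictlyMonotonic N)
    (hmonoDual : OrthantStrictlyMonotonic (dualNorm N))
    (F : Finset (Fin d) → ℝ) (hF : Monotone F) :
    -- `L₀^F` is proper convex lsc
    ProperConvexLsc (calL0 N F) ∧
    -- it coincides with `F ∘ supp` on the unit sphere
    (∀ x : Vec d, N x = 1 → (F (supp x) : EReal) = calL0 N F x) ∧
    -- hidden convexity
    (∀ x : Vec d, (F (supp x) : EReal) = calL0 N F (normalization N x)) ∧
    (∀ x : Vec d, x ≠ 0 → (F (supp x) : EReal) = calL0 N F ((N x)⁻¹ • x)) ∧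
    -- expression as a Fenchel conjugate
    calL0 N F = fenchelConj (fun y => ⨆ K, ((topDualNorm N K y - F K : ℝ) : EReal)) ∧
    -- largest proper convex lsc minorant, with balls
    (IsLargestProperConvexLscBelow (calL0 N F) (infCharFun (supportBall N) F) ∧
      IsLargestProperConvexLscBelow (calL0 N F)
        (fun x => sInf ((fun K => (F K : EReal)) '' {K | x ∈ supportBall N K}))) ∧
    -- largest proper convex lsc minorant, with spheres
    (IsLargestProperConvexLscBelow (calL0 N F) (infCharFun (supportSphere N) F) ∧
      IsLargestProperConvexLscBelow (calL0 N F)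
        (fun x => sInf ((fun K => (F K : EReal)) '' {K | x ∈ supportSphere N K}))) ∧
    -- variational expressions
    (∀ x : Vec d, IsMinOver (calL0 N F x) (feasibleWeights (supportBall N) x)
      (fun μ => ∑ K, μ K * F K)) ∧
    (∀ x : Vec d, IsMinOver (calL0 N F x) (feasibleWeights (supportSphere N) x)
      (fun μ => ∑ K, μ K * F K)) ∧
    (F ∅ = 0 → ∀ x : Vec d, IsMinOver (calL0 N F x) (feasibleDecompositions N x)
      (fun z => ∑ K, supportDualNorm N K.1 (z K) * F K.1)) := by

  have hSB := supportSphere_subset_supportBall hN hmonoDual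
  have hball : IsLargestProperConvexLscBelow (calL0 N F) (infCharFun (supportBall N) F) :=
    isLargest_calL0 hN hmono hmonoDual hF hSB fun _ => subset_rfl
  have hsphere : IsLargestProperConvexLscBelow (calL0 N F) (infCharFun (supportSphere N) F) :=
    isLargest_calL0 hN hmono hmonoDual hF (fun _ => subset_rfl) hSB
  refine ⟨properConvexLsc_calL0 hN hmono hF,
    fun x hx => calL0_eq_of_seminorm_eq_one hN hmono hmonoDual hF hx, fun x => ?_,
    fun x hx => calL0_inv_smul hN hmono hmonoDual hF hx, ?_,
    ⟨hball, infCharFun_eq_sInf (supportBall N) F ▸ hball⟩,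
    ⟨hsphere, infCharFun_eq_sInf (supportSphere N) F ▸ hsphere⟩,
    isMinOver_feasibleWeights hN hmono hmonoDual hF hSB fun _ => subset_rfl,
    isMinOver_feasibleWeights hN hmono hmonoDual hF (fun _ => subset_rfl) hSB,
    isMinOver_feasibleDecompositions hN hmono hmonoDual hF⟩
  · rw [normalization]
    split_ifs with hx
    · rw [calL0_zero hN hmono hF, hx, Finset.subset_empty.1 (supp_subset (zero_mem (flat ∅)))]
    · exact calL0_inv_smul hN hmono hmonoDual hF hx
  · rw [calL0_eq hN hmono hF, funext (iSup_topDualNorm_sub hmonoDual)]
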